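/- Let $d\ge 1$, let $\mathbb N=\{1,2,\dots\}$ and let $\mathcal H=\ell^2(\mathbb N,\mathbb C^d)$. For sequences $(a_x)_{x\ge1},(s_x)_{x\ge 1},(b_x)_{x\ge1}$ of complex $d\times d$ matrices, put $a_0=\mathbf 1$ and let $$(H_oy)_x=y_{x-1}+y_{x+1},\qquad (V_cy)_x=(a_{x-1}-\mathbf 1)y_{x-1}+b_xy_x+(s_x-\mathbf 1)y_{x+1},\qquad x\in\mathbb N,\ y_0=0 .$$ For $p\ge1$ and $q\in\{2p-1,2p\}$ let $\mathbb J_q^c$ be the class of operators $V_c$ such that all $a_x,s_x$ are invertible, $a_x=s_x=\mathbf 1$ and $b_x=0$ for $x>p$, and moreover: if $q=2p-1$, then $a_p=s_p=\mathbf 1$ and $b_p$ is invertible; if $q=2p$, then $\mathbf 1-s_pa_p$ is invertible. Let $\mathbb J_q\subset\mathbb J_q^c$ be the subclass with $a_x=s_x>0$ (positive definite) and $b_x=b_x^*$ for all $x\ge1$. Let $V_c\in\mathbb J_q^c$. There is a unique sequence $(f_x)_{x\ge0}$ of matrix-valued polynomials in $k$ (the Jost solution) such that $a_{x-1}f_{x-1}(k)+b_xf_x(k)+s_xf_{x+1}(k)=(k+k^{-1})f_x(k)$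 for all $x\ge1$, $k\in\mathbb C\setminus\{0\}$, and $f_x(k)=k^x\mathbf 1$ for all $x>p$. Let $\phi(k)=\det f_0(k)$ be the Jost determinant and let $\mathcal T_p=a_1^{-1}a_2^{-1}\cdots a_p^{-1}$. For $0<|k|<1$ and $\lambda(k)=k+k^{-1}$, the operator $H_o-\lambda(k)$ is invertible and, with $R_o(\lambda)=(H_o-\lambda)^{-1}$, the operator $V_cR_o(\lambda(k))$ has finite rank. Put $$D_c(k)=\det\bigl(I+V_cR_o(\lambda(k))\bigr)\quad(0<|k|<1),\qquad D_c(0)=1,$$ the latter corresponding to $\lambda(0)=\infty$, $R_o(\infty)=0$. Then $$\phi(k)=D_c(k)\det\mathcal T_p\qquad\text{for all } |k|<1 .$$ The function $D_c$ is the restriction to the unit disc of a polynomial, and with this polynomial in place of $D_c$ the identity holds for all $k\in\mathbb C$. If moreover $V_c\in\mathbb J_q$, then $\phi$ is real on $\mathbb R$, and the resonances (the zeros of $\phi$ in $\{|k|>1\}$ together with those at $k=\pm1$) are symmetric with respect to the real line; more precisely, for every $k\in\mathbb C$, the number $k$ is a resonance if and only if $\overline k$ is, and $k$ and $\overline k$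 have the same multiplicity as zeros of $\phi$. -/

import Mathlib

open Polynomial

noncomputable section

/-- The Hilbert space `ℓ²(ℕ, ℂ^d)`. The half-lattice `{1, 2, 3, …}` is indexed from zero:
the value of a sequence at the lattice site `x ≥ 1` is `y (x - 1)`, see `siteValue`. -/
abbrev LatticeSpace (d : ℕ) : Type := lp (fun _ : ℕ => EuclideanSpace ℂ (Fin d)) 2

/-- The value `y_x` of `y` at the site `x`, with the boundary convention `y_0 = 0`. -/
def siteValue {d : ℕ} (y : LatticeSpace d) : ℕ → EuclideanSpace ℂ (Fin d)
  | 0 => 0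
  | n + 1 => y n

theorem siteValue_add {d : ℕ} (y z : LatticeSpace d) (x : ℕ) :
    siteValue (y + z) x = siteValue y x + siteValue z x := by
  cases x <;> simp [siteValue]

theorem siteValue_smul {d : ℕ} (c : ℂ) (y : LatticeSpace d) (x : ℕ) :
    siteValue (c • y) x = c • siteValue y x := by
  cases x <;> simp [siteValue]

theorem continuous_siteValue {d : ℕ} (x : ℕ) :
    Continuous fun y : LatticeSpace d => siteValue y x := by
  cases x with
  | zero => exact continuous_const
  | succ n =>
    exact (lp.evalCLM ℂ (fun _ : ℕ => EuclideanSpace ℂ (Fin d)) 2 n).continuous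

theorem memlp_two_iff {d : ℕ} (u : ℕ → EuclideanSpace ℂ (Fin d)) :
    Memℓp u 2 ↔ Summable fun n => ‖u n‖ ^ 2 := by
  rw [memℓp_gen_iff (by norm_num)]
  simp

theorem lattice_norm_sq {d : ℕ} (y : LatticeSpace d) : ‖y‖ ^ 2 = ∑' n, ‖y n‖ ^ 2 := by
  have h := lp.norm_rpow_eq_tsum (p := 2) (by norm_num) y
  simpa using h

theorem summable_lattice {d : ℕ} (y : LatticeSpace d) : Summable fun n => ‖y n‖ ^ 2 :=
  (memlp_two_iff _).1 (lp.memℓp y)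

/-- The operator `(S y)_x = y_{x-1}`. -/
def shiftRight (d : ℕ) : LatticeSpace d →L[ℂ] LatticeSpace d :=
  LinearMap.mkContinuous
    { toFun := fun y => ⟨fun n => siteValue y n, (memlp_two_iff _).2
        ((summable_nat_add_iff 1).1 (by simpa [siteValue] using summable_lattice y))⟩
      map_add' := fun y z => by ext n : 2; exact siteValue_add y z n
      map_smul' := fun c y => by ext n : 2; exact siteValue_smul c y n } 1
    (fun y => by
      rw [one_mul]
      refine le_of_sq_le_sq ?_ (norm_nonneg _)
      rw [lattice_norm_sq, lattice_norm_sq]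
      refine le_of_eq ?_
      have hs : Summable fun n => ‖siteValue y n‖ ^ 2 :=
        (summable_nat_add_iff 1).1 (by simpa [siteValue] using summable_lattice y)
      change ∑' n, ‖siteValue y n‖ ^ 2 = _
      rw [hs.tsum_eq_zero_add]
      simp [siteValue])

/-- The operator `(S y)_x = y_{x+1}`. -/
def shiftLeft (d : ℕ) : LatticeSpace d →L[ℂ] LatticeSpace d :=
  LinearMap.mkContinuous
    { toFun := fun y => ⟨fun n => siteValue y (n + 2), (memlp_two_iff _).2
        ((summable_nat_add_iff 1).2 (summable_lattice y))⟩
      map_add' := fun y z => by ext n : 2; exact siteValue_add y z (n + 2)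
      map_smul' := fun c y => by ext n : 2; exact siteValue_smul c y (n + 2) } 1
    (fun y => by
      rw [one_mul]
      refine le_of_sq_le_sq ?_ (norm_nonneg _)
      rw [lattice_norm_sq, lattice_norm_sq]
      change ∑' n, ‖y (n + 1)‖ ^ 2 ≤ _
      rw [(summable_lattice y).tsum_eq_zero_add]
      exact le_add_of_nonneg_left (by positivity))

/-- The discrete Laplacian `(H_o y)_x = y_{x-1} + y_{x+1}` on the half-lattice. -/
def freeOp (d : ℕ) : LatticeSpace d →L[ℂ] LatticeSpace d := shiftRight d + shiftLeft d

theorem siteValue_freeOp {d : ℕ} (y : LatticeSpace d) (x : ℕ) :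
    siteValue (freeOp d y) (x + 1) = siteValue y x + siteValue y (x + 2) := rfl

/-- Finitely supported coefficients of a matrix-valued Jacobi operator. The coefficients with
index `x ≥ 1` are the data, `a_0 = 1` is a convention, and `s_0`, `b_0` are never used. -/
structure JacobiPerturbation (d : ℕ) where
  /-- the coefficients below the diagonal -/
  a : ℕ → Matrix (Fin d) (Fin d) ℂ
  /-- the coefficients above the diagonal -/
  s : ℕ → Matrix (Fin d) (Fin d) ℂ
  /-- the diagonal coefficients -/
  b : ℕ → Matrix (Fin d) (Fin d) ℂ
  a_zero : a 0 = 1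
  finite_support : ∃ N, ∀ x, N < x → a x = 1 ∧ s x = 1 ∧ b x = 0

namespace JacobiPerturbation

variable {d : ℕ} (V : JacobiPerturbation d)

/-- `(V_c y)_x = (a_{x-1} - 1) y_{x-1} + b_x y_x + (s_x - 1) y_{x+1}` at the site `x = n + 1`. -/
def opValue (y : LatticeSpace d) (n : ℕ) : EuclideanSpace ℂ (Fin d) :=
  (V.a n - 1).toEuclideanLin (siteValue y n) + (V.b (n + 1)).toEuclideanLin (siteValue y (n + 1))
    + (V.s (n + 1) - 1).toEuclideanLin (siteValue y (n + 2))

theorem exists_opValue_eq_zero : ∃ N, ∀ y n, N ≤ n → V.opValue y n = 0 := by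
  obtain ⟨N, hN⟩ := V.finite_support
  refine ⟨N + 1, fun y n hn => ?_⟩
  simp [opValue, hN n (by omega), hN (n + 1) (by omega)]

theorem continuous_opValue (n : ℕ) : Continuous fun y => V.opValue y n := by
  unfold opValue
  exact (((LinearMap.continuous_of_finiteDimensional _).comp (continuous_siteValue _)).add
    ((LinearMap.continuous_of_finiteDimensional _).comp (continuous_siteValue _))).add
    ((LinearMap.continuous_of_finiteDimensional _).comp (continuous_siteValue _))

/-- `V_c` as a linear map. -/
def opLin : LatticeSpace d →ₗ[ℂ] LatticeSpace d where
  toFun y := ⟨V.opValue y, (memlp_two_iff _).2 (by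
    obtain ⟨N, hN⟩ := V.exists_opValue_eq_zero
    refine summable_of_ne_finset_zero (s := Finset.range N) fun n hn => ?_
    rw [hN y n (by simpa using hn)]
    simp)⟩
  map_add' y z := by
    ext n : 2
    change V.opValue (y + z) n = V.opValue y n + V.opValue z n
    simp only [opValue, siteValue_add, map_add]
    abel
  map_smul' c y := by
    ext n : 2
    change V.opValue (c • y) n = c • V.opValue y n
    simp only [opValue, siteValue_smul, map_smul, smul_add]

/-- The bounded operator `V_c` on `ℓ²`. -/
def op : LatticeSpace d →L[ℂ] LatticeSpace d where
  toLinearMap := V.opLin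
  cont := by
    obtain ⟨N, hN⟩ := V.exists_opValue_eq_zero
    have h : ∀ y, V.opLin y = ∑ n ∈ Finset.range N,
        lp.singleContinuousLinearMap ℂ (fun _ : ℕ => EuclideanSpace ℂ (Fin d)) 2 n
          (V.opValue y n) := by
      intro y
      ext m : 2
      rw [lp.coeFn_sum, Finset.sum_apply]
      change V.opValue y m = _
      by_cases hm : m < N
      · rw [Finset.sum_eq_single m]
        · simp
        · intro n _ hnm
          simp [Ne.symm hnm]
        · intro h
          exact absurd (Finset.mem_range.2 hm) h
      · rw [hN y m (by omega), Finset.sum_eq_zero]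
        intro n hn
        have : m ≠ n := by
          have := Finset.mem_range.1 hn
          omega
        simp [this]
    have h' : (V.opLin : LatticeSpace d → LatticeSpace d) = fun y => ∑ n ∈ Finset.range N,
        lp.singleContinuousLinearMap ℂ (fun _ : ℕ => EuclideanSpace ℂ (Fin d)) 2 n
          (V.opValue y n) := funext h
    change Continuous (V.opLin : LatticeSpace d → LatticeSpace d)
    rw [h']
    exact continuous_finsetSum _ fun n _ =>
      (ContinuousLinearMap.continuous _).comp (V.continuous_opValue n)

theorem siteValue_op (y : LatticeSpace d) (x : ℕ) :
    siteValue (V.op y) (x + 1) = (V.a x - 1).toEuclideanLin (siteValue y x)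
      + (V.b (x + 1)).toEuclideanLin (siteValue y (x + 1))
      + (V.s (x + 1) - 1).toEuclideanLin (siteValue y (x + 2)) := rfl

/-- The class `J_q^c`, for `q = 2 p - 1` or `q = 2 p`. -/
structure MemJc (p q : ℕ) : Prop where
  det_a : ∀ x, 1 ≤ x → (V.a x).det ≠ 0
  det_s : ∀ x, 1 ≤ x → (V.s x).det ≠ 0
  support : ∀ x, p < x → V.a x = 1 ∧ V.s x = 1 ∧ V.b x = 0
  odd_case : q + 1 = 2 * p → V.a p = 1 ∧ V.s p = 1 ∧ (V.b p).det ≠ 0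
  even_case : q = 2 * p → (1 - V.s p * V.a p).det ≠ 0

open scoped ComplexOrder in
/-- The class `J_q` of self-adjoint perturbations. -/
structure MemJ (p q : ℕ) : Prop extends V.MemJc p q where
  a_eq_s : ∀ x, 1 ≤ x → V.a x = V.s x
  a_posDef : ∀ x, 1 ≤ x → (V.a x).PosDef
  b_hermitian : ∀ x, 1 ≤ x → (V.b x).IsHermitian

/-- The matrix `T_p = a_1⁻¹ a_2⁻¹ ⋯ a_p⁻¹`. -/
def invProd (p : ℕ) : Matrix (Fin d) (Fin d) ℂ :=
  ((List.range p).map fun j => (V.a (j + 1))⁻¹).prod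

/-- `f = (f_x)_{x ≥ 0}` is the Jost solution: the `f_x` are matrix-valued polynomials in `k` with
`a_{x-1} f_{x-1}(k) + s_x f_{x+1}(k) + b_x f_x(k) = (k + k⁻¹) f_x(k)` for `x ≥ 1`, `k ≠ 0`
(`x` is written `x + 1` below), and `f_x(k) = k^x` for `x > p`. -/
structure IsJostSolution (p : ℕ) (f : ℕ → Matrix (Fin d) (Fin d) ℂ[X]) : Prop where
  equation : ∀ k : ℂ, k ≠ 0 → ∀ x : ℕ,
    V.a x * (f x).map (eval k) + V.s (x + 1) * (f (x + 2)).map (eval k)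
      + V.b (x + 1) * (f (x + 1)).map (eval k) = (k + k⁻¹) • (f (x + 1)).map (eval k)
  eq_pow : ∀ x : ℕ, p < x → ∀ k : ℂ,
    (f x).map (eval k) = k ^ x • (1 : Matrix (Fin d) (Fin d) ℂ)

end JacobiPerturbation

/-- The determinant `det (I + A)` of a finite-rank operator `A`, that is, the determinant of
`I + A` on the invariant finite-dimensional subspace `ran A`. -/
def fredholmDet {E : Type*} [NormedAddCommGroup E] [NormedSpace ℂ E] (A : E →L[ℂ] E) : ℂ :=
  LinearMap.det (1 + (A : E →ₗ[ℂ] E).restrict (p := LinearMap.range (A : E →ₗ[ℂ] E))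
    (q := LinearMap.range (A : E →ₗ[ℂ] E)) fun x _ => LinearMap.mem_range_self _ x)

open Classical in
/-- The free resolvent `R_o(λ) = (H_o - λ)⁻¹` at `λ = k + k⁻¹`; the point `k = 0` corresponds
to `λ = ∞`, where the resolvent vanishes. -/
def freeResolvent (d : ℕ) (k : ℂ) : LatticeSpace d →L[ℂ] LatticeSpace d :=
  if k = 0 then 0 else Ring.inverse (freeOp d - (k + k⁻¹) • 1)

/-- The Fredholm determinant `D_c(k) = det (I + V_c R_o(λ(k)))`, for `k` in the unit disc. -/
def JacobiPerturbation.fredholmD {d : ℕ} (V : JacobiPerturbation d) (k : ℂ) : ℂ :=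
  fredholmDet (V.op ∘L freeResolvent d k)

/-- `k` is a resonance: a zero of the Jost determinant `φ` outside the closed unit disc, or
a zero at one of the points `±1`. -/
def IsResonance (φ : ℂ[X]) (k : ℂ) : Prop :=
  φ.eval k = 0 ∧ (1 < ‖k‖ ∨ k = 1 ∨ k = -1)

end

/-! Both sides reduce to one finite block matrix, `truncation`: the operator H_o + V_c - λ(k) on the
sites 1, …, p + 1, closed by the boundary condition y_{p+2} = k y_{p+1}, which the Jost solution
satisfies, as does R_o z for every z supported on those sites. Let T be this matrix.

On the Jost side (`truncationDet_mul_pow`), column operations that insert the Jost solution as a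
block column make T block triangular with diagonal -f_0, a_1, …, a_p. Hence det T · k^{(p+1)d} = ±
det f_0 · ∏ det a_j, with a sign depending only on d and p.

On the Fredholm side (`fredholm_truncation`), D_c(k) = det T · G(k), where G(k) is the determinant
of R_o compressed to the sites 1, …, p + 1 and does not depend on V_c. For V_c = 0 the left side is
1 and T is known, so comparison with the free case removes both G and the sign (`fredholmD_mul_eq`):
D_c = det f_0 · ∏ det a_j. The point k = 0 is computed from the recursion for f_x / k^x.

In the self-adjoint case T is Hermitian for real k ≠ 0, so φ is real there; a polynomial real at
infinitely many real points has real coefficients, which gives the symmetry. -/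

open Polynomial

noncomputable section

/-! ### Determinants of block matrices. -/

namespace Matrix

theorem det_comp_of_upperTriangular {m n R : Type*} [Fintype m] [DecidableEq m] [Fintype n]
    [LinearOrder n] [CommRing R] {M : Matrix n n (Matrix m m R)}
    (hM : ∀ i j, j < i → M i j = 0) : (comp n n m m R M).det = ∏ i, (M i i).det := by
  have h : (comp n n m m R M).BlockTriangular Prod.fst := by
    rintro ⟨i, a⟩ ⟨j, b⟩ hij
    simp [comp_apply, hM i j hij]
  rw [h.det_fintype]
  refine Finset.prod_congr rfl fun i _ => ?_
  let e : m ≃ {x : n × m // x.1 = i} :=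
    { toFun := fun a => ⟨(i, a), rfl⟩
      invFun := fun x => x.1.2
      left_inv := fun a => rfl
      right_inv := by rintro ⟨⟨j, a⟩, rfl⟩; rfl }
  rw [← det_submatrix_equiv_self e]
  rfl

theorem det_comp_submatrix_right {m n R : Type*} [Fintype m] [DecidableEq m] [Fintype n]
    [DecidableEq n] [CommRing R] (M : Matrix n n (Matrix m m R)) (σ : Equiv.Perm n) :
    (comp n n m m R (M.submatrix id σ)).det =
      (Equiv.Perm.sign (σ.prodCongr (Equiv.refl m)) : ℤ) * (comp n n m m R M).det := by
  rw [← det_permute']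
  rfl

end Matrix

/-! ### The truncated operator and the Jost determinant. -/

namespace JacobiPerturbation

variable {d : ℕ} (V : JacobiPerturbation d)

/-- The operator `H_o + V - (k + k⁻¹)` on the sites `1, …, p + 1`, acting on the restrictions of
sequences which satisfy `y_{p+2} = k y_{p+1}`. -/
def truncation (p : ℕ) (k : ℂ) :
    Matrix (Fin (p + 1)) (Fin (p + 1)) (Matrix (Fin d) (Fin d) ℂ) :=
  Matrix.of fun i j =>
    (if (j : ℕ) + 1 = i then V.a i else 0)
      + (if (j : ℕ) = i then
          V.b (i + 1) - (k + k⁻¹) • 1 + (if (i : ℕ) = p then k • 1 else 0) else 0)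
      + if (j : ℕ) = i + 1 then V.s (i + 1) else 0

/-- The determinant of `truncation`, as a matrix of complex numbers. -/
def truncationDet (p : ℕ) (k : ℂ) : ℂ :=
  (Matrix.comp _ _ _ _ ℂ (V.truncation p k)).det

/-- The biadditive `A` allows two uses: matrix products, for the Jost solution, and matrices acting
on vectors, for sequences in ℓ². Here `F j` stands for the value at the site j + 1, and row 0 has no
a_0 term. -/
theorem sum_truncation_mul (p : ℕ) (k : ℂ) {S : Type*} [AddCommMonoid S]
    (A : Matrix (Fin d) (Fin d) ℂ →+ S →+ S) (F : ℕ → S) (i : Fin (p + 1)) :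
    ∑ j : Fin (p + 1), A (V.truncation p k i j) (F j) =
      (if (i : ℕ) = 0 then 0 else A (V.a i) (F (i - 1)))
        + A (V.b (i + 1) - (k + k⁻¹) • 1 + (if (i : ℕ) = p then k • 1 else 0)) (F i)
        + if (i : ℕ) = p then 0 else A (V.s (i + 1)) (F (i + 1)) := by
  have key : ∀ j n : ℕ, ∀ X : Matrix (Fin d) (Fin d) ℂ, ∀ (P : Prop) [Decidable P], (P ↔ j = n) →
      A (if P then X else 0) (F j) = if j = n then A X (F n) else 0 := by
    intro j n X P _ h
    by_cases hj : j = n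
    · rw [if_pos (h.2 hj), if_pos hj, hj]
    · rw [if_neg (fun hP => hj (h.1 hP)), if_neg hj, map_zero, AddMonoidHom.zero_apply]
  have aux : ∀ (n : ℕ) (Y : S), ∑ j : Fin (p + 1), (if (j : ℕ) = n then Y else 0) =
      if n < p + 1 then Y else 0 := by
    intro n Y
    rw [Fin.sum_univ_eq_sum_range (fun i => if i = n then Y else 0), Finset.sum_ite_eq']
    simp
  have hsplit : ∀ X Y Z : Matrix (Fin d) (Fin d) ℂ, ∀ y : S,
      A (X + Y + Z) y = A X y + A Y y + A Z y := by
    intro X Y Z y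
    rw [map_add, map_add, AddMonoidHom.add_apply, AddMonoidHom.add_apply]
  simp only [truncation, Matrix.of_apply, hsplit, Finset.sum_add_distrib]
  congr 1
  · congr 1
    · split_ifs with hi
      · refine Finset.sum_eq_zero fun j _ => ?_
        rw [if_neg (by omega), map_zero, AddMonoidHom.zero_apply]
      · rw [Finset.sum_congr rfl fun (j : Fin (p + 1)) _ =>
          key j (i - 1) (V.a i) ((j : ℕ) + 1 = i) (by omega), aux, if_pos (by omega)]
    · rw [Finset.sum_congr rfl fun (j : Fin (p + 1)) _ =>
        key j i (V.b (i + 1) - (k + k⁻¹) • 1 + (if (i : ℕ) = p then k • 1 else 0))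
          ((j : ℕ) = i) Iff.rfl, aux, if_pos i.2]
  · rw [Finset.sum_congr rfl fun (j : Fin (p + 1)) _ =>
      key j (i + 1) (V.s (i + 1)) ((j : ℕ) = i + 1) Iff.rfl, aux]
    have := i.2
    split_ifs <;> first | rfl | omega

/-- The Jost equation for the values of the Jost solution at `k`. -/
structure IsJostValue (p : ℕ) (k : ℂ) (f : ℕ → Matrix (Fin d) (Fin d) ℂ) : Prop where
  equation : ∀ x, V.a x * f x + V.s (x + 1) * f (x + 2) + V.b (x + 1) * f (x + 1)
    = (k + k⁻¹) • f (x + 1)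
  eq_pow : ∀ x, p < x → f x = k ^ x • 1

/-- The quantifier over `V` comes after `u`, so that the same sign serves the free operator and can
later be cancelled. -/
theorem truncationDet_mul_pow (d p : ℕ) : ∃ u : ℤˣ, ∀ (V : JacobiPerturbation d) (k : ℂ)
    (f : ℕ → Matrix (Fin d) (Fin d) ℂ), V.s (p + 1) = 1 → V.IsJostValue p k f →
    V.truncationDet p k * k ^ ((p + 1) * d) =
      ((u : ℤ) : ℂ) * (f 0).det * ∏ j ∈ Finset.range p, (V.a (j + 1)).det := by
  let σ : Equiv.Perm (Fin (p + 1)) := finRotate (p + 1)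
  -- The permutation sign comes from rotating the block columns of `M`, and (-1)^d from det(-f_0).
  refine ⟨Equiv.Perm.sign (σ.prodCongr (Equiv.refl (Fin d))) * (-1) ^ d,
    fun V k f hs hf => ?_⟩
  let M : Matrix (Fin (p + 1)) (Fin (p + 1)) (Matrix (Fin d) (Fin d) ℂ) :=
    Matrix.of fun i j => if j = 0 then f (i + 1) else if (i : ℕ) + 1 = j then 1 else 0
  have hσ : ∀ j : Fin (p + 1), (j : ℕ) < p → ((σ j : Fin (p + 1)) : ℕ) = j + 1 := by
    intro j hj
    rw [coe_finRotate_of_ne_last]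
    rintro rfl
    simp at hj
  have hσ' : ∀ j : Fin (p + 1), (j : ℕ) = p → σ j = 0 := by
    intro j hj
    rw [show j = Fin.last p from Fin.ext hj, finRotate_last]
  have hM : (Equiv.Perm.sign (σ.prodCongr (Equiv.refl (Fin d))) : ℤ) *
      (Matrix.comp _ _ _ _ ℂ M).det = k ^ ((p + 1) * d) := by
    rw [← Matrix.det_comp_submatrix_right, Matrix.det_comp_of_upperTriangular]
    · rw [Fin.prod_univ_castSucc, Finset.prod_eq_one, one_mul]
      · simp only [Matrix.submatrix_apply, M, Matrix.of_apply, hσ' (Fin.last p) rfl, if_true, id]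
        rw [hf.eq_pow _ (by simp), Matrix.det_smul]
        simp [pow_mul]
      · intro i _
        have h1 := hσ i.castSucc i.2
        have : σ i.castSucc ≠ 0 := fun h => by simp [h] at h1
        simp only [Matrix.submatrix_apply, M, Matrix.of_apply, if_neg this, id, h1, if_true,
          Matrix.det_one]
    · intro i j hij
      have h1 := hσ j (by omega)
      have : σ j ≠ 0 := fun h => by simp [h] at h1
      simp only [Matrix.submatrix_apply, M, Matrix.of_apply, if_neg this, id, h1]
      rw [if_neg]
      have : (j : ℕ) < i := hij
      omega
  -- The Jost equation annihilates every row except the first, where the missing term a_0 f_0 = f_0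
  -- leaves -f_0.
  have hcol : ∀ i : Fin (p + 1), (V.truncation p k * M) i 0 = if i = 0 then -f 0 else 0 := by
    intro i
    rw [Matrix.mul_apply]
    simp only [M, Matrix.of_apply, if_true]
    refine (V.sum_truncation_mul p k AddMonoidHom.mul (fun n => f (n + 1)) i).trans ?_
    have h := hf.equation i
    -- In the last row the boundary term k f_{p+1} = k^{p+2} replaces s_{p+1} f_{p+2}.
    have hlast : (if (i : ℕ) = p then (k • 1 : Matrix (Fin d) (Fin d) ℂ) else 0) * f (i + 1)
        + (if (i : ℕ) = p then 0 else V.s (i + 1) * f (i + 2)) = V.s (i + 1) * f (i + 2) := by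
      split_ifs with hi
      · rw [hi, hs, hf.eq_pow _ (by omega), hf.eq_pow _ (by omega)]
        simp [pow_succ, smul_smul, mul_comm]
      · simp
    have hfirst : (if (i : ℕ) = 0 then 0 else V.a i * f (i - 1 + 1)) =
        V.a i * f i + if i = 0 then -f 0 else 0 := by
      by_cases hi : (i : ℕ) = 0
      · have : i = 0 := Fin.ext hi
        simp [this, V.a_zero]
      · rw [if_neg hi, if_neg (fun h => hi (by simp [h])), Nat.sub_add_cancel (by omega), add_zero]
    simp only [AddMonoidHom.mul_apply]
    rw [hfirst, add_mul, sub_mul, smul_mul_assoc, one_mul, add_assoc, add_assoc, ← h,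
      show (i : ℕ) + 1 + 1 = i + 2 from rfl]
    rw [add_assoc (_ - _), hlast]
    abel
  have hcol' : ∀ i j : Fin (p + 1), ∀ n : Fin (p + 1), (j : ℕ) = n + 1 →
      (V.truncation p k * M) i j = V.truncation p k i n := by
    intro i j n hj
    have hj0 : j ≠ 0 := fun h => by simp [h] at hj
    rw [Matrix.mul_apply, Finset.sum_eq_single n]
    · simp [M, hj0, hj]
    · intro m _ hm
      have : (m : ℕ) ≠ n := fun h => hm (Fin.ext h)
      simp [M, hj0, hj, this]
    · simp
  -- The remaining columns are those of the truncation moved one place to the right, so its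
  -- subdiagonal a_1, …, a_p becomes the diagonal.
  have hprod : (Matrix.comp _ _ _ _ ℂ (V.truncation p k * M)).det =
      (-1) ^ d * (f 0).det * ∏ j ∈ Finset.range p, (V.a (j + 1)).det := by
    rw [Matrix.det_comp_of_upperTriangular, Fin.prod_univ_succ, hcol, if_pos rfl, Matrix.det_neg,
      Fintype.card_fin, ← Fin.prod_univ_eq_prod_range (fun j => (V.a (j + 1)).det)]
    · congr 1
      refine Finset.prod_congr rfl fun j _ => ?_
      rw [hcol' _ _ j.castSucc (by simp)]
      simp [truncation, add_assoc]
    · intro i j hij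
      have hij' : (j : ℕ) < i := hij
      by_cases hj : j = 0
      · subst hj
        rw [hcol, if_neg hij.ne']
      · have hj' : (j : ℕ) ≠ 0 := fun h => hj (Fin.ext h)
        rw [hcol' i j ⟨j - 1, by omega⟩ (by simp; omega)]
        simp only [truncation, Matrix.of_apply]
        rw [if_neg (by omega), if_neg (by omega), if_neg (by omega)]
        simp
  have hmul : (Matrix.comp _ _ _ _ ℂ (V.truncation p k * M)).det =
      V.truncationDet p k * (Matrix.comp _ _ _ _ ℂ M).det := by
    rw [truncationDet, ← Matrix.det_mul]
    congr 1
    exact map_mul (Matrix.compRingEquiv (Fin (p + 1)) (Fin d) ℂ) _ _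
  rw [← hM, mul_left_comm, ← hmul, hprod]
  push_cast
  ring

end JacobiPerturbation
-- Finite-rank determinants and the free resolvent.
theorem LinearMap.det_one_add_comp_comm {K M N : Type*} [Field K] [AddCommGroup M] [Module K M]
    [FiniteDimensional K M] [AddCommGroup N] [Module K N] [FiniteDimensional K N]
    (f : M →ₗ[K] N) (g : N →ₗ[K] M) :
    LinearMap.det (1 + f ∘ₗ g) = LinearMap.det (1 + g ∘ₗ f) := by
  let b := Module.finBasis K M
  let c := Module.finBasis K N
  rw [← LinearMap.det_toMatrix c, ← LinearMap.det_toMatrix b, map_add, map_add,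
    LinearMap.toMatrix_comp c b c, LinearMap.toMatrix_comp b c b, LinearMap.toMatrix_one,
    LinearMap.toMatrix_one, Matrix.det_one_add_mul_comm]

/-- On its range, `A` factors as (A J) ∘ Q through `X`, so det(1 + fg) = det(1 + gf) moves the
determinant to `X`. -/
theorem fredholmDet_eq_of_comp {E X : Type*} [NormedAddCommGroup E] [NormedSpace ℂ E]
    [AddCommGroup X] [Module ℂ X] [FiniteDimensional ℂ X] (A : E →L[ℂ] E) (J : X →ₗ[ℂ] E)
    (Q : E →ₗ[ℂ] X) (h : ∀ y, J (Q (A y)) = A y) :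
    FiniteDimensional ℂ (LinearMap.range (A : E →ₗ[ℂ] E)) ∧
      fredholmDet A = LinearMap.det (1 + Q ∘ₗ (A : E →ₗ[ℂ] E) ∘ₗ J) := by
  have hfin : FiniteDimensional ℂ (LinearMap.range (A : E →ₗ[ℂ] E)) := by
    refine Submodule.finiteDimensional_of_le (S₂ := LinearMap.range J) ?_
    rintro _ ⟨y, rfl⟩
    exact ⟨Q (A y), h y⟩
  refine ⟨hfin, ?_⟩
  let f : X →ₗ[ℂ] LinearMap.range (A : E →ₗ[ℂ] E) := (A : E →ₗ[ℂ] E).rangeRestrict ∘ₗ J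
  let g : LinearMap.range (A : E →ₗ[ℂ] E) →ₗ[ℂ] X := Q ∘ₗ Submodule.subtype _
  have h1 : (A : E →ₗ[ℂ] E).restrict (p := LinearMap.range (A : E →ₗ[ℂ] E))
      (q := LinearMap.range (A : E →ₗ[ℂ] E)) (fun x _ => LinearMap.mem_range_self _ x)
      = f ∘ₗ g := by
    ext ⟨_, y, rfl⟩
    change A (A y) = A (J (Q (A y)))
    rw [h]
  have h2 : g ∘ₗ f = Q ∘ₗ (A : E →ₗ[ℂ] E) ∘ₗ J := rfl
  rw [fredholmDet, h1, LinearMap.det_one_add_comp_comm, h2]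

theorem norm_shiftRight_le (d : ℕ) : ‖shiftRight d‖ ≤ 1 :=
  LinearMap.mkContinuous_norm_le _ zero_le_one _

theorem norm_shiftLeft_le (d : ℕ) : ‖shiftLeft d‖ ≤ 1 :=
  LinearMap.mkContinuous_norm_le _ zero_le_one _

theorem siteValue_zero {d : ℕ} (y : LatticeSpace d) : siteValue y 0 = 0 := rfl

theorem siteValue_ext {d : ℕ} {y z : LatticeSpace d}
    (h : ∀ x, siteValue y (x + 1) = siteValue z (x + 1)) : y = z := by
  ext n : 2
  exact h n

theorem siteValue_sub {d : ℕ} (y z : LatticeSpace d) (x : ℕ) :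
    siteValue (y - z) x = siteValue y x - siteValue z x := by
  cases x <;> simp [siteValue]

theorem norm_siteValue_le {d : ℕ} (y : LatticeSpace d) (x : ℕ) : ‖siteValue y x‖ ≤ ‖y‖ := by
  cases x with
  | zero => simp [siteValue]
  | succ n => exact lp.norm_apply_le_norm (by norm_num) y n

theorem shiftLeft_mul_shiftRight (d : ℕ) : shiftLeft d * shiftRight d = 1 := by
  ext1 y
  exact siteValue_ext fun x => rfl

/-- The factorization rests on `shiftLeft * shiftRight = 1`. For ‖k‖ < 1 each factor is invertible
by a Neumann series. -/
theorem freeOp_sub_eq (d : ℕ) {k : ℂ} (hk : k ≠ 0) :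
    freeOp d - (k + k⁻¹) • 1 = (-k⁻¹) • ((1 - k • shiftLeft d) * (1 - k • shiftRight d)) := by
  rw [sub_mul, one_mul, mul_sub, mul_one, smul_mul_smul_comm, shiftLeft_mul_shiftRight, freeOp]
  ext1 y
  simp only [sub_apply, add_apply, smul_apply, one_apply_eq_self]
  match_scalars <;> field_simp
  ring

theorem isUnit_one_sub_smul {d : ℕ} {k : ℂ} (hk : ‖k‖ < 1)
    {T : LatticeSpace d →L[ℂ] LatticeSpace d} (hT : ‖T‖ ≤ 1) : IsUnit (1 - k • T) := by
  have h : ‖k • T‖ < 1 := by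
    rw [norm_smul]
    exact (mul_le_of_le_one_right (norm_nonneg _) hT).trans_lt hk
  exact (Units.oneSub _ h).isUnit

theorem isUnit_freeOp_sub (d : ℕ) {k : ℂ} (hk : k ≠ 0) (hk1 : ‖k‖ < 1) :
    IsUnit (freeOp d - (k + k⁻¹) • 1) := by
  rw [freeOp_sub_eq d hk]
  have h := (isUnit_one_sub_smul hk1 (norm_shiftLeft_le d)).mul
    (isUnit_one_sub_smul hk1 (norm_shiftRight_le d))
  have hk' : IsUnit (-k⁻¹) := (neg_ne_zero.2 (inv_ne_zero hk)).isUnit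
  exact h.smul hk'.unit

theorem freeOp_sub_freeResolvent {d : ℕ} {k : ℂ} (hk : k ≠ 0) (hk1 : ‖k‖ < 1)
    (z : LatticeSpace d) :
    (freeOp d - (k + k⁻¹) • 1) (freeResolvent d k z) = z := by
  have h := Ring.mul_inverse_cancel _ (isUnit_freeOp_sub d hk hk1)
  rw [freeResolvent, if_neg hk]
  exact congrArg (fun T : LatticeSpace d →L[ℂ] LatticeSpace d => T z) h

/-- A solution of `(H_o - λ) y = z` decays like `k ^ x` off the support of `z`. -/
theorem siteValue_succ_of_freeOp_sub {d : ℕ} {k : ℂ} (hk : k ≠ 0) (hk1 : ‖k‖ < 1)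
    {y z : LatticeSpace d} (h : (freeOp d - (k + k⁻¹) • 1) y = z) {N : ℕ}
    (hz : ∀ x, N < x → siteValue z x = 0) (x : ℕ) (hx : N ≤ x) :
    siteValue y (x + 1) = k • siteValue y x := by
  set u := (1 - k • shiftRight d) y with hu
  have hux : ∀ x, siteValue u (x + 1) = siteValue y (x + 1) - k • siteValue y x := fun x => rfl
  -- Off the support of `z` the factor 1 - k `shiftLeft` annihilates `u`; iterating u_x = k u_{x+1}
  -- on a bounded sequence forces u_x = 0 beyond `N`, that is, y_{x+1} = k y_x for x ≥ N.
  have hstep : ∀ x, N < x → siteValue u x = k • siteValue u (x + 1) := by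
    intro x hx
    obtain ⟨n, rfl⟩ : ∃ n, x = n + 1 := ⟨x - 1, by omega⟩
    have h1 := congrArg (fun w => siteValue w (n + 1)) h
    simp only [hz _ hx] at h1
    rw [freeOp_sub_eq d hk] at h1
    have h2 : (-k⁻¹) • (siteValue u (n + 1) - k • siteValue u (n + 2)) = 0 := h1
    exact sub_eq_zero.1 ((smul_eq_zero.1 h2).resolve_left (neg_ne_zero.2 (inv_ne_zero hk)))
  have hpow : ∀ m, siteValue u (x + 1) = k ^ m • siteValue u (x + 1 + m) := by
    intro m
    induction m with
    | zero => simp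
    | succ m ih => rw [ih, hstep (x + 1 + m) (by omega), smul_smul, pow_succ]; rfl
  have hle : ∀ m : ℕ, ‖siteValue u (x + 1)‖ ≤ ‖k‖ ^ m * ‖u‖ := by
    intro m
    rw [hpow m, norm_smul, norm_pow]
    exact mul_le_mul_of_nonneg_left (norm_siteValue_le _ _) (by positivity)
  have hlim : Filter.Tendsto (fun m : ℕ => ‖k‖ ^ m * ‖u‖) Filter.atTop (nhds 0) := by
    simpa using (tendsto_pow_atTop_nhds_zero_of_lt_one (norm_nonneg k) hk1).mul_const ‖u‖
  have h0 : ‖siteValue u (x + 1)‖ ≤ 0 := ge_of_tendsto' hlim hle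
  rw [norm_le_zero_iff, hux] at h0
  exact sub_eq_zero.1 h0

/-- The values at the sites `1, …, p + 1`. -/
def siteRestrict (d p : ℕ) : LatticeSpace d →ₗ[ℂ] (Fin (p + 1) × Fin d → ℂ) where
  toFun y i := siteValue y (i.1 + 1) i.2
  map_add' y z := by ext i; simp [siteValue_add]
  map_smul' c y := by ext i; simp [siteValue_smul]

theorem siteRestrict_apply {d p : ℕ} (y : LatticeSpace d) (i : Fin (p + 1)) (a : Fin d) :
    siteRestrict d p y (i, a) = siteValue y (i + 1) a := rfl

/-- The value at the site `n + 1` of the extension by zero of `w`. -/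
def siteExtendValue {d p : ℕ} (w : Fin (p + 1) × Fin d → ℂ) (n : ℕ) : EuclideanSpace ℂ (Fin d) :=
  if h : n < p + 1 then WithLp.toLp 2 fun a => w (⟨n, h⟩, a) else 0

/-- Extension by zero from the sites `1, …, p + 1`. -/
def siteExtend (d p : ℕ) : (Fin (p + 1) × Fin d → ℂ) →ₗ[ℂ] LatticeSpace d where
  toFun w := ⟨siteExtendValue w,
    (memlp_two_iff _).2 (summable_of_ne_finset_zero (s := Finset.range (p + 1)) fun n hn => by
      rw [siteExtendValue, dif_neg (by simpa using hn)]; simp)⟩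
  map_add' v w := by
    ext n : 2
    change siteExtendValue (v + w) n = siteExtendValue v n + siteExtendValue w n
    unfold siteExtendValue
    split_ifs
    · rfl
    · simp
  map_smul' c w := by
    ext n : 2
    change siteExtendValue (c • w) n = c • siteExtendValue w n
    unfold siteExtendValue
    split_ifs
    · rfl
    · simp

theorem siteValue_siteExtend {d p : ℕ} (w : Fin (p + 1) × Fin d → ℂ) (n : ℕ) :
    siteValue (siteExtend d p w) (n + 1) =
      if h : n < p + 1 then WithLp.toLp 2 fun a => w (⟨n, h⟩, a) else 0 := rfl

theorem siteRestrict_siteExtend {d p : ℕ} (w : Fin (p + 1) × Fin d → ℂ) :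
    siteRestrict d p (siteExtend d p w) = w := by
  ext ⟨i, a⟩
  rw [siteRestrict_apply, siteValue_siteExtend, dif_pos i.2]

theorem siteExtend_siteRestrict {d p : ℕ} {y : LatticeSpace d}
    (hy : ∀ n, p < n → siteValue y (n + 1) = 0) : siteExtend d p (siteRestrict d p y) = y := by
  refine siteValue_ext fun n => ?_
  rw [siteValue_siteExtend]
  split_ifs with h
  · rfl
  · exact (hy n (by omega)).symm

/-! ### The Fredholm determinant through the truncated operator. -/

namespace JacobiPerturbation

variable {d : ℕ} (V : JacobiPerturbation d)

theorem siteValue_op_eq_zero {p : ℕ} (hV : ∀ x, p < x → V.a x = 1 ∧ V.s x = 1 ∧ V.b x = 0)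
    (y : LatticeSpace d) {n : ℕ} (hn : p < n) : siteValue (V.op y) (n + 1) = 0 := by
  rw [siteValue_op, (hV n hn).1, (hV (n + 1) (by omega)).2.1, (hV (n + 1) (by omega)).2.2]
  simp

/-- The boundary condition makes the last row agree with the full operator, as s_{p+1} y_{p+2} = k
y_{p+1}; the first row agrees because y_0 = 0. -/
theorem truncation_mulVec_siteRestrict {p : ℕ} {k : ℂ} (hs : V.s (p + 1) = 1)
    {y : LatticeSpace d} (hy : siteValue y (p + 2) = k • siteValue y (p + 1)) :
    (Matrix.comp _ _ _ _ ℂ (V.truncation p k)).mulVec (siteRestrict d p y) =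
      siteRestrict d p (V.op y + (freeOp d - (k + k⁻¹) • 1) y) := by
  ext ⟨i, a⟩
  let A : Matrix (Fin d) (Fin d) ℂ →+ EuclideanSpace ℂ (Fin d) →+ EuclideanSpace ℂ (Fin d) :=
    AddMonoidHom.mk' (fun X => X.toEuclideanLin.toAddMonoidHom) (fun X Y => by
      ext; simp)
  have hA : ∀ X v, A X v = X.toEuclideanLin v := fun X v => rfl
  have h1 : (Matrix.comp _ _ _ _ ℂ (V.truncation p k)).mulVec (siteRestrict d p y) (i, a) =
      (∑ j : Fin (p + 1), A (V.truncation p k i j) (siteValue y (j + 1))) a := by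
    simp only [Matrix.mulVec, dotProduct, Fintype.sum_prod_type, hA]
    rw [WithLp.ofLp_sum, Finset.sum_apply]
    rfl
  have h2 := V.sum_truncation_mul p k A (fun n => siteValue y (n + 1)) i
  rw [h1, h2, siteRestrict_apply]
  refine congrArg (fun v : EuclideanSpace ℂ (Fin d) => v a) ?_
  rw [siteValue_add, siteValue_op, sub_apply, siteValue_sub,
    siteValue_freeOp, smul_apply, siteValue_smul,
    one_apply_eq_self]
  simp only [hA]
  simp only [map_add, map_sub, map_smul, LinearMap.add_apply, LinearMap.sub_apply,
    LinearMap.smul_apply]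
  have hone : ∀ v : EuclideanSpace ℂ (Fin d), (1 : Matrix (Fin d) (Fin d) ℂ).toEuclideanLin v = v :=
    fun v => by ext; simp
  have hfirst : (if (i : ℕ) = 0 then 0 else (V.a i).toEuclideanLin (siteValue y (i - 1 + 1))) =
      (V.a i).toEuclideanLin (siteValue y i) := by
    split_ifs with hi
    · rw [hi, siteValue_zero, map_zero]
    · rw [Nat.sub_add_cancel (by omega)]
  have hlast : (if (i : ℕ) = p then k • (1 : Matrix (Fin d) (Fin d) ℂ) else 0).toEuclideanLin
      (siteValue y (i + 1)) + (if (i : ℕ) = p then 0 else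
        (V.s (i + 1)).toEuclideanLin (siteValue y (i + 1 + 1))) =
      (V.s (i + 1)).toEuclideanLin (siteValue y (i + 2)) := by
    split_ifs with hi
    · rw [hi, hs, hone, hy, map_smul, LinearMap.smul_apply, hone, add_zero]
    · simp
  rw [hfirst, hone, hone, hone]
  generalize (if (i : ℕ) = p then 0 else
    (V.s (i + 1)).toEuclideanLin (siteValue y (i + 1 + 1))) = Y at *
  rw [← hlast]
  abel

/-- With Q, J the restriction and the extension by zero, and y = R_o J w, applying the truncation to
Q y gives Q V_c y + w. So 1 + Q V_c R_o J is the truncation times Q R_o J. -/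
theorem fredholm_truncation {p : ℕ} (hV : ∀ x, p < x → V.a x = 1 ∧ V.s x = 1 ∧ V.b x = 0)
    {k : ℂ} (hk : k ≠ 0) (hk1 : ‖k‖ < 1) :
    FiniteDimensional ℂ
        (LinearMap.range (V.op ∘L freeResolvent d k : LatticeSpace d →ₗ[ℂ] LatticeSpace d)) ∧
      V.fredholmD k = V.truncationDet p k * LinearMap.det
        (siteRestrict d p ∘ₗ (freeResolvent d k : LatticeSpace d →ₗ[ℂ] LatticeSpace d)
          ∘ₗ siteExtend d p) := by
  obtain ⟨h1, h2⟩ := fredholmDet_eq_of_comp (V.op ∘L freeResolvent d k) (siteExtend d p)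
    (siteRestrict d p) fun y => siteExtend_siteRestrict fun n hn => V.siteValue_op_eq_zero hV _ hn
  refine ⟨h1, ?_⟩
  rw [fredholmD, h2, truncationDet, ← LinearMap.det_toLin', ← LinearMap.det_comp]
  congr 1
  refine LinearMap.ext fun w => ?_
  have hres := freeOp_sub_freeResolvent hk hk1 (siteExtend d p w)
  have hdecay := siteValue_succ_of_freeOp_sub hk hk1 hres (N := p + 1) (fun x hx => by
    obtain ⟨n, rfl⟩ : ∃ n, x = n + 1 := ⟨x - 1, by omega⟩
    rw [siteValue_siteExtend, dif_neg (by omega)]) (p + 1) le_rfl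
  have h := V.truncation_mulVec_siteRestrict (hV (p + 1) (by omega)).2.1 hdecay
  rw [hres, map_add, siteRestrict_siteExtend, add_comm _ w] at h
  exact h.symm

/-- The vanishing perturbation. -/
def free (d : ℕ) : JacobiPerturbation d where
  a _ := 1
  s _ := 1
  b _ := 0
  a_zero := rfl
  finite_support := ⟨0, fun _ _ => ⟨rfl, rfl, rfl⟩⟩

theorem op_free (d : ℕ) : (free d).op = 0 := by
  ext1 y
  refine siteValue_ext fun x => ?_
  rw [siteValue_op]
  simp [free, siteValue]

theorem fredholmD_free (d : ℕ) (k : ℂ) : (free d).fredholmD k = 1 := by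
  -- The zero operator factors through the zero space, where every determinant is 1.
  obtain ⟨-, h⟩ := fredholmDet_eq_of_comp (X := Fin 0 → ℂ) ((free d).op ∘L freeResolvent d k) 0 0
    fun y => by simp [op_free]
  rw [fredholmD, h]
  simp

theorem fredholmD_zero : V.fredholmD 0 = 1 := by
  obtain ⟨-, h⟩ := fredholmDet_eq_of_comp (X := Fin 0 → ℂ) (V.op ∘L freeResolvent d 0) 0 0
    fun y => by simp [freeResolvent]
  rw [fredholmD, h]
  simp

theorem isJostValue_free (d p : ℕ) {k : ℂ} (hk : k ≠ 0) :
    (free d).IsJostValue p k fun x => k ^ x • 1 where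
  equation x := by
    simp only [free, one_mul, zero_mul, add_zero, smul_smul, ← add_smul]
    congr 1
    field_simp
    ring
  eq_pow _ _ := rfl

/-- For the free operator f_0 = 1, and the two determinant formulas give k^{(p+1)d} = u G.
Substituting this for the power of k in the formula for `V` leaves only the common factor `u` to
cancel. -/
theorem fredholmD_mul_eq {p : ℕ} (hV : ∀ x, p < x → V.a x = 1 ∧ V.s x = 1 ∧ V.b x = 0)
    {k : ℂ} (hk : k ≠ 0) (hk1 : ‖k‖ < 1) {f : ℕ → Matrix (Fin d) (Fin d) ℂ}
    (hf : V.IsJostValue p k f) :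
    V.fredholmD k = (f 0).det * ∏ j ∈ Finset.range p, (V.a (j + 1)).det := by
  obtain ⟨u, hu⟩ := truncationDet_mul_pow d p
  have hfree := (fredholm_truncation (free d) (p := p) (fun _ _ => ⟨rfl, rfl, rfl⟩) hk hk1).2
  have h := (V.fredholm_truncation hV hk hk1).2
  have hu0 := hu (free d) k _ rfl (isJostValue_free d p hk)
  have hu1 := hu V k f (hV (p + 1) (by omega)).2.1 hf
  rw [fredholmD_free] at hfree
  have hu' : ((u : ℤ) : ℂ) ≠ 0 := by exact_mod_cast u.ne_zero
  have hu2 : (free d).truncationDet p k * k ^ ((p + 1) * d) = (u : ℤ) := by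
    rw [hu0]; simp [free]
  rw [h]
  generalize LinearMap.det (siteRestrict d p ∘ₗ
    (freeResolvent d k : LatticeSpace d →ₗ[ℂ] LatticeSpace d) ∘ₗ siteExtend d p) = G at *
  have hG : k ^ ((p + 1) * d) = (u : ℤ) * G := by
    rw [← hu2]
    linear_combination k ^ ((p + 1) * d) * hfree
  rw [hG] at hu1
  refine mul_left_cancel₀ hu' ?_
  linear_combination hu1

end JacobiPerturbation
-- Existence and uniqueness of the Jost solution, and the determinant identity.
theorem Polynomial.matrix_ext_of_eval {m : Type*} {A B : Matrix m m ℂ[X]}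
    (h : ∀ k : ℂ, k ≠ 0 → A.map (eval k) = B.map (eval k)) : A = B := by
  ext1 i j
  refine eq_of_infinite_eval_eq _ _ ((Set.finite_singleton (0 : ℂ)).infinite_compl.mono ?_)
  intro k hk
  exact congrFun (congrFun (h k hk) i) j

theorem Polynomial.eval_matrix_det {m : Type*} [Fintype m] [DecidableEq m] (A : Matrix m m ℂ[X])
    (k : ℂ) : A.det.eval k = (A.map (eval k)).det :=
  RingHom.map_det (evalRingHom k) A

namespace JacobiPerturbation

variable {d : ℕ} (V : JacobiPerturbation d)

theorem IsJostValue.unique {V : JacobiPerturbation d} {p : ℕ} {k : ℂ}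
    {f g : ℕ → Matrix (Fin d) (Fin d) ℂ} (ha : ∀ x, (V.a x).det ≠ 0)
    (hf : V.IsJostValue p k f) (hg : V.IsJostValue p k g) : f = g := by
  -- Downward induction on the site: since a_x is invertible, f_{x+1} and f_{x+2} determine f_x.
  have key : ∀ n x, p < x + n → f x = g x := by
    intro n
    induction n with
    | zero => intro x hx; rw [hf.eq_pow x hx, hg.eq_pow x hx]
    | succ n ih =>
      intro x hx
      have h1 := hf.equation x
      have h2 := hg.equation x
      rw [ih (x + 1) (by omega), ih (x + 2) (by omega), ← h2] at h1
      have hu : IsUnit (V.a x) := (Matrix.isUnit_iff_isUnit_det _).2 (ha x).isUnit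
      exact hu.mul_left_cancel (add_right_cancel (add_right_cancel h1))
  exact funext fun x => key (p + 1) x (by omega)

theorem IsJostSolution.isJostValue {V : JacobiPerturbation d} {p : ℕ}
    {f : ℕ → Matrix (Fin d) (Fin d) ℂ[X]} (hf : V.IsJostSolution p f) {k : ℂ} (hk : k ≠ 0) :
    V.IsJostValue p k fun x => (f x).map (eval k) :=
  ⟨hf.equation k hk, fun x hx => hf.eq_pow x hx k⟩

theorem IsJostSolution.unique {V : JacobiPerturbation d} {p : ℕ}
    {f g : ℕ → Matrix (Fin d) (Fin d) ℂ[X]} (ha : ∀ x, (V.a x).det ≠ 0)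
    (hf : V.IsJostSolution p f) (hg : V.IsJostSolution p g) : f = g :=
  funext fun x => matrix_ext_of_eval fun _ hk =>
    congrFun ((hf.isJostValue hk).unique ha (hg.isJostValue hk)) x

/-- The matrix polynomials `g_x` such that the Jost solution is `f_x(k) = k ^ x g_x(k)`. -/
def jostFactor (p x : ℕ) : Matrix (Fin d) (Fin d) ℂ[X] :=
  if p < x then 1 else
    (V.a x)⁻¹.map C * ((1 + X ^ 2 : ℂ[X]) • jostFactor p (x + 1)
      - (X : ℂ[X]) • ((V.b (x + 1)).map C * jostFactor p (x + 1))
      - (X ^ 2 : ℂ[X]) • ((V.s (x + 1)).map C * jostFactor p (x + 2)))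
termination_by p + 1 - x

theorem jostFactor_of_lt {p x : ℕ} (h : p < x) : V.jostFactor p x = 1 := by
  rw [jostFactor, if_pos h]

theorem eval_jostFactor_of_le {p x : ℕ} (h : x ≤ p) (k : ℂ) :
    (V.jostFactor p x).map (eval k) =
      (V.a x)⁻¹ * ((1 + k ^ 2) • (V.jostFactor p (x + 1)).map (eval k)
      - k • (V.b (x + 1) * (V.jostFactor p (x + 1)).map (eval k))
      - k ^ 2 • (V.s (x + 1) * (V.jostFactor p (x + 2)).map (eval k))) := by
  rw [jostFactor, if_neg (by omega)]
  let ev := (evalRingHom k).mapMatrix (m := Fin d)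
  have hC : ∀ M : Matrix (Fin d) (Fin d) ℂ, ev (M.map C) = M := fun M => by ext; simp [ev]
  have hsmul : ∀ (P : ℂ[X]) (M : Matrix (Fin d) (Fin d) ℂ[X]), ev (P • M) = P.eval k • ev M :=
    fun P M => by ext; simp [ev]
  change ev _ = _ * (_ • ev _ - _ • (_ * ev _) - _ • (_ * ev _))
  simp only [map_mul, map_sub, hC, hsmul]
  simp

/-- The Jost solution. -/
def jostSolution (p x : ℕ) : Matrix (Fin d) (Fin d) ℂ[X] :=
  (X ^ x : ℂ[X]) • V.jostFactor p x

theorem eval_jostSolution (p x : ℕ) (k : ℂ) :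
    (V.jostSolution p x).map (eval k) = k ^ x • (V.jostFactor p x).map (eval k) := by
  ext; simp [jostSolution]

/-- Substituting f_x = k^x g_x and dividing by k^x turns the Jost equation into a_x g_x = (1 + k²)
g_{x+1} - k b_{x+1} g_{x+1} - k² s_{x+1} g_{x+2}, free of k⁻¹; hence the g_x are polynomials. -/
theorem isJostSolution_jostSolution {p : ℕ} (ha : ∀ x, (V.a x).det ≠ 0)
    (hV : ∀ x, p < x → V.a x = 1 ∧ V.s x = 1 ∧ V.b x = 0) :
    V.IsJostSolution p (V.jostSolution p) where
  equation k hk x := by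
    simp only [eval_jostSolution]
    have hone : (1 : Matrix (Fin d) (Fin d) ℂ[X]).map (eval k) = 1 :=
      (evalRingHom k).mapMatrix.map_one
    by_cases hx : p < x
    · rw [V.jostFactor_of_lt hx, V.jostFactor_of_lt (by omega : p < x + 1),
        V.jostFactor_of_lt (by omega : p < x + 2), (hV x hx).1, (hV (x + 1) (by omega)).2.1,
        (hV (x + 1) (by omega)).2.2, hone]
      exact (isJostValue_free d p hk).equation x
    · rw [mul_smul_comm, V.eval_jostFactor_of_le (not_lt.1 hx),
        Matrix.mul_nonsing_inv_cancel_left _ _ (ha x).isUnit, mul_smul_comm, mul_smul_comm]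
      match_scalars <;> field_simp <;> ring
  eq_pow x hx k := by
    rw [eval_jostSolution, V.jostFactor_of_lt hx]
    congr 1
    exact (evalRingHom k).mapMatrix.map_one

theorem det_invProd (p : ℕ) : (V.invProd p).det =
    (∏ j ∈ Finset.range p, (V.a (j + 1)).det)⁻¹ := by
  induction p with
  | zero => simp [invProd]
  | succ p ih =>
    have h : V.invProd (p + 1) = V.invProd p * (V.a (p + 1))⁻¹ := by
      simp [invProd, List.range_succ]
    rw [h, Matrix.det_mul, ih, Finset.prod_range_succ, mul_inv, Matrix.det_nonsing_inv,
      Ring.inverse_eq_inv']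

theorem eval_zero_det_jostSolution (p : ℕ) :
    (V.jostSolution p 0).det.eval 0 = (V.invProd p).det := by
  -- At k = 0 the recursion collapses to g_x(0) = a_x⁻¹ g_{x+1}(0).
  have key : ∀ n, n ≤ p + 1 → ((V.jostFactor p 0).map (eval 0)).det =
      (∏ j ∈ Finset.range n, (V.a j).det)⁻¹ * ((V.jostFactor p n).map (eval 0)).det := by
    intro n
    induction n with
    | zero => simp
    | succ n ih =>
      intro hn
      rw [ih (by omega), V.eval_jostFactor_of_le (by omega : n ≤ p), Finset.prod_range_succ,
        mul_inv, Matrix.det_mul, Matrix.det_nonsing_inv, Ring.inverse_eq_inv']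
      simp [mul_assoc]
  rw [eval_matrix_det, eval_jostSolution, pow_zero, one_smul, key (p + 1) le_rfl, det_invProd,
    Finset.prod_range_succ', V.a_zero, V.jostFactor_of_lt (by omega)]
  simp

theorem det_jost_eq {p : ℕ} (ha : ∀ x, (V.a x).det ≠ 0)
    (hV : ∀ x, p < x → V.a x = 1 ∧ V.s x = 1 ∧ V.b x = 0)
    {f : ℕ → Matrix (Fin d) (Fin d) ℂ[X]} (hf : V.IsJostSolution p f) {k : ℂ} (hk : ‖k‖ < 1) :
    (f 0).det.eval k = V.fredholmD k * (V.invProd p).det := by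
  by_cases hk0 : k = 0
  · rw [hk0, V.fredholmD_zero, one_mul, hf.unique ha (V.isJostSolution_jostSolution ha hV),
      V.eval_zero_det_jostSolution]
  · rw [V.fredholmD_mul_eq hV hk0 hk (hf.isJostValue hk0), V.det_invProd, eval_matrix_det]
    rw [mul_assoc, mul_inv_cancel₀ (Finset.prod_ne_zero_iff.2 fun j _ => ha (j + 1)), mul_one]

/-! ### Reality of the Jost determinant and symmetry of resonances. -/

theorem star_truncationDet {p : ℕ} (has : ∀ x, 1 ≤ x → V.a x = V.s x)
    (ha : ∀ x, 1 ≤ x → (V.a x).IsHermitian) (hb : ∀ x, 1 ≤ x → (V.b x).IsHermitian) (t : ℝ) :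
    starRingEnd ℂ (V.truncationDet p t) = V.truncationDet p t := by
  -- For real `t` the boundary term `t • 1` is Hermitian too, and a_x = s_x exchanges the two
  -- off-diagonals.
  have hH : ∀ i j, (V.truncation p t i j).conjTranspose = V.truncation p t j i := by
    intro i j
    simp only [truncation, Matrix.of_apply, Matrix.conjTranspose_add]
    rcases lt_trichotomy (i : ℕ) j with h | h | h
    · rw [if_neg (show ¬(j : ℕ) + 1 = i by omega), if_neg (show ¬(j : ℕ) = i by omega),
        if_neg (show ¬(i : ℕ) = j by omega), if_neg (show ¬(i : ℕ) = j + 1 by omega)]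
      by_cases h' : (j : ℕ) = i + 1
      · rw [if_pos h', if_pos h'.symm, ← has _ (by omega), h']
        simp [(ha (i + 1) (by omega)).eq]
      · rw [if_neg h', if_neg (Ne.symm h')]
        simp
    · obtain rfl : i = j := Fin.ext h
      have hb' := (hb (i + 1) (by omega)).eq
      split_ifs <;> first | omega | simp [hb']
    · rw [if_neg (show ¬(j : ℕ) = i by omega), if_neg (show ¬(i : ℕ) = j by omega),
        if_neg (show ¬(j : ℕ) = i + 1 by omega), if_neg (show ¬(i : ℕ) + 1 = j by omega)]
      by_cases h' : (i : ℕ) = j + 1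
      · rw [if_pos h', if_pos h'.symm, ← has _ (by omega), h']
        simp [(ha (j + 1) (by omega)).eq]
      · rw [if_neg h', if_neg (Ne.symm h')]
        simp
  rw [truncationDet, starRingEnd_apply, ← Matrix.det_conjTranspose]
  congr 1
  ext ⟨i, a⟩ ⟨j, b⟩
  exact congrFun (congrFun (hH j i) a) b

open scoped ComplexOrder in
theorem MemJ.a_hermitian {V : JacobiPerturbation d} {p q : ℕ} (hV : V.MemJ p q) (x : ℕ)
    (hx : 1 ≤ x) : (V.a x).IsHermitian :=
  (hV.a_posDef x hx).isHermitian

theorem map_conj_det_jost {p : ℕ} (has : ∀ x, 1 ≤ x → V.a x = V.s x)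
    (ha : ∀ x, 1 ≤ x → (V.a x).IsHermitian) (hb : ∀ x, 1 ≤ x → (V.b x).IsHermitian)
    (hdet : ∀ x, (V.a x).det ≠ 0) (hs : V.s (p + 1) = 1)
    {f : ℕ → Matrix (Fin d) (Fin d) ℂ[X]} (hf : V.IsJostSolution p f) :
    (f 0).det.map (starRingEnd ℂ) = (f 0).det := by
  -- Every factor in `truncationDet_mul_pow` other than det f_0 is real here, and the formula needs
  -- no bound on |t|.
  have hreal : ∀ t : ℝ, t ≠ 0 →
      starRingEnd ℂ ((f 0).det.eval (t : ℂ)) = (f 0).det.eval (t : ℂ) := by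
    intro t ht
    have ht' : (t : ℂ) ≠ 0 := by exact_mod_cast ht
    obtain ⟨u, hu⟩ := truncationDet_mul_pow d p
    have h := hu V t _ hs (hf.isJostValue ht')
    rw [← eval_matrix_det] at h
    have h' := congrArg (starRingEnd ℂ) h
    have hprod : starRingEnd ℂ (∏ j ∈ Finset.range p, (V.a (j + 1)).det) =
        ∏ j ∈ Finset.range p, (V.a (j + 1)).det := by
      rw [map_prod]
      refine Finset.prod_congr rfl fun j _ => ?_
      rw [starRingEnd_apply, ← Matrix.det_conjTranspose, (ha (j + 1) (by omega)).eq]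
    simp only [map_mul, map_pow, V.star_truncationDet has ha hb, Complex.conj_ofReal, hprod,
      map_intCast] at h'
    have hu' : ((u : ℤ) : ℂ) ≠ 0 := by exact_mod_cast u.ne_zero
    have hp : ∏ j ∈ Finset.range p, (V.a (j + 1)).det ≠ 0 :=
      Finset.prod_ne_zero_iff.2 fun j _ => hdet (j + 1)
    exact mul_left_cancel₀ hu' (mul_right_cancel₀ hp (h'.symm.trans h))
  refine eq_of_infinite_eval_eq _ _ ?_
  refine ((Set.finite_singleton (0 : ℝ)).infinite_compl.image
    (Complex.ofReal_injective.injOn)).mono ?_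
  rintro _ ⟨t, ht, rfl⟩
  have h := eval_map_apply (f := starRingEnd ℂ) (p := (f 0).det) (t : ℂ)
  rw [Complex.conj_ofReal] at h
  exact h.trans (hreal t ht)

end JacobiPerturbation

theorem IsResonance.conj {φ : ℂ[X]} (h : φ.map (starRingEnd ℂ) = φ) {k : ℂ}
    (hk : IsResonance φ k) : IsResonance φ (starRingEnd ℂ k) := by
  refine ⟨?_, ?_⟩
  · rw [← h, eval_map_apply, hk.1, map_zero]
  · rcases hk.2 with h1 | rfl | rfl
    · exact Or.inl (by rwa [RCLike.norm_conj])
    · exact Or.inr (Or.inl (map_one _))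
    · exact Or.inr (Or.inr (by simp))

end

theorem theorem1p2 (d p q : ℕ) (hd : 1 ≤ d) (hp : 1 ≤ p) (hq : q + 1 = 2 * p ∨ q = 2 * p)
    (V : JacobiPerturbation d) (hV : V.MemJc p q) :
    (∀ k : ℂ, k ≠ 0 → ‖k‖ < 1 →
      IsUnit (freeOp d - (k + k⁻¹) • 1) ∧
      FiniteDimensional ℂ
        (LinearMap.range (V.op ∘L freeResolvent d k : LatticeSpace d →ₗ[ℂ] LatticeSpace d))) ∧
    (∃! f, V.IsJostSolution p f) ∧
    ∀ f, V.IsJostSolution p f →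
      (∀ k : ℂ, ‖k‖ < 1 → (f 0).det.eval k = V.fredholmD k * (V.invProd p).det) ∧
      (∃ P : ℂ[X], (∀ k : ℂ, ‖k‖ < 1 → P.eval k = V.fredholmD k) ∧
        ∀ k : ℂ, (f 0).det.eval k = P.eval k * (V.invProd p).det) ∧
      (V.MemJ p q →
        (∀ t : ℝ, ((f 0).det.eval (t : ℂ)).im = 0) ∧
        ∀ k : ℂ,
          (IsResonance (f 0).det k ↔ IsResonance (f 0).det (starRingEnd ℂ k)) ∧
          (f 0).det.rootMultiplicity k = (f 0).det.rootMultiplicity (starRingEnd ℂ k)) := by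
  have ha : ∀ x, (V.a x).det ≠ 0 := by
    intro x
    cases x with
    | zero => simp [V.a_zero]
    | succ x => exact hV.det_a _ (by omega)
  have hT : (V.invProd p).det ≠ 0 := by
    rw [V.det_invProd]
    exact inv_ne_zero (Finset.prod_ne_zero_iff.2 fun j _ => ha (j + 1))
  have hJ := V.isJostSolution_jostSolution ha hV.support
  refine ⟨fun k hk hk1 => ⟨isUnit_freeOp_sub d hk hk1,
    (V.fredholm_truncation hV.support hk hk1).1⟩, ⟨_, hJ, fun g hg => hg.unique ha hJ⟩,
    fun f hf => ⟨fun k hk => V.det_jost_eq ha hV.support hf hk,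
      ⟨C (V.invProd p).det⁻¹ * (f 0).det, fun k hk => ?_, fun k => ?_⟩, fun hVJ => ?_⟩⟩
  · rw [eval_mul, eval_C, V.det_jost_eq ha hV.support hf hk]
    field_simp
  · rw [eval_mul, eval_C]
    field_simp
  · have hmap := V.map_conj_det_jost hVJ.a_eq_s hVJ.a_hermitian
      hVJ.b_hermitian ha (hV.support (p + 1) (by omega)).2.1 hf
    refine ⟨fun t => ?_, fun k => ⟨⟨IsResonance.conj hmap, fun h => ?_⟩, ?_⟩⟩
    · have h := eval_map_apply (f := starRingEnd ℂ) (p := (f 0).det) (t : ℂ)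
      rw [hmap, Complex.conj_ofReal] at h
      exact Complex.conj_eq_iff_im.1 h.symm
    · simpa using h.conj hmap
    -- Conjugating the coefficients carries a root `k` to its conjugate with the same multiplicity,
    -- and here it fixes the polynomial.
    · conv_rhs => rw [← hmap]
      exact eq_rootMultiplicity_map (starRingEnd ℂ).injective k
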